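/- Let $d\ge 0$ and let $X\subset\mathbb C^d$ be an irreducible complex variety that is defined by real polynomials, i.e. $X$ is the set of common zeros in $\mathbb C^d$ of some set of polynomials in $\mathbb R[x_1,\dots,x_d]$, and whenever $X=Y\cup Z$ with $Y,Z$ subvarieties of $X$, then $X=Y$ or $X=Z$. Let $\mathcal I(X)\subset\mathbb C[x_1,\dots,x_d]$ be the ideal of all polynomials vanishing on $X$, with generators $f_1,\dots,f_s$. A point $x\in X$ is smooth if the rank of the Jacobian matrix $(\partial f_i/\partial x_j)$ at $x$ equals the maximum of the ranks of this matrix at the points of $X$ (this does not depend on the choice of generators). Let $X(\mathbb R):=X\cap\mathbb R^d$ be the set of real points of $X$. If $X$ has a smooth real point, that is, if some point of $X(\mathbb R)$ is a smooth point of $X$, then $X(\mathbb R)$ is Zariski dense in $X$: its closure in the Zariski topology of $\mathbb C^d$, whose closed sets are the varieties, contains $X$. Equivalently, every polynomial in $\mathbb C[x_1,\dots,x_d]$ that vanishes on $X(\mathbb R)$ vanishes on all of $X$. -/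

import Mathlib

/-- The variety `V(S)` in affine `d`-space over `ℂ` cut out by a set `S` of complex polynomials. -/
def complexZeros {d : ℕ} (S : Set (MvPolynomial (Fin d) ℂ)) : Set (Fin d → ℂ) :=
  {x | ∀ f ∈ S, MvPolynomial.eval x f = 0}

/-- A subset of `ℂ^d` is a variety if it is the set of common zeros of some set of polynomials. -/
def IsVariety {d : ℕ} (X : Set (Fin d → ℂ)) : Prop :=
  ∃ S : Set (MvPolynomial (Fin d) ℂ), X = complexZeros S

/-- `X` is the set of common complex zeros of some set of polynomials with real coefficients. -/
def IsDefinedByRealPolynomials {d : ℕ} (X : Set (Fin d → ℂ)) : Prop :=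
  ∃ S : Set (MvPolynomial (Fin d) ℝ), X = {x | ∀ f ∈ S, MvPolynomial.aeval x f = 0}

/-- A variety is irreducible if it is not the union of two proper subvarieties. -/
def IsIrreducibleVariety {d : ℕ} (X : Set (Fin d → ℂ)) : Prop :=
  IsVariety X ∧ ∀ Y Z : Set (Fin d → ℂ), IsVariety Y → IsVariety Z → X = Y ∪ Z → X = Y ∨ X = Z

/-- The set `X(ℝ) = X ∩ ℝ^d` of real points of `X`. -/
def realPoints {d : ℕ} (X : Set (Fin d → ℂ)) : Set (Fin d → ℂ) :=
  X ∩ Set.range (fun (y : Fin d → ℝ) (i : Fin d) => (y i : ℂ))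

/-- The Jacobian matrix `(∂ fᵢ / ∂ xⱼ)` evaluated at the point `x`. -/
noncomputable def jacobianMatrix {d s : ℕ} (f : Fin s → MvPolynomial (Fin d) ℂ)
    (x : Fin d → ℂ) : Matrix (Fin s) (Fin d) ℂ :=
  Matrix.of fun i j => MvPolynomial.eval x (MvPolynomial.pderiv j (f i))

/-- `x` is a smooth point of the (irreducible) variety `X`: for generators `f₁, …, f_s` of the full
ideal `I(X)` of polynomials vanishing on `X`, the Jacobian matrix has at `x` the maximal rank that
it attains on `X`. The choice of generators is immaterial, see `isSmoothPoint_iff`. -/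
def IsSmoothPoint {d : ℕ} (X : Set (Fin d → ℂ)) (x : Fin d → ℂ) : Prop :=
  x ∈ X ∧ ∃ (s : ℕ) (f : Fin s → MvPolynomial (Fin d) ℂ),
    Ideal.span (Set.range f) = MvPolynomial.vanishingIdeal ℂ X ∧
    ∀ y ∈ X, (jacobianMatrix f y).rank ≤ (jacobianMatrix f x).rank

/-- At points of `X` the Jacobian matrix of generators of `I(X)` has as its rank the dimension of
the space of gradients of all members of `I(X)`. -/
theorem rank_jacobianMatrix {d s : ℕ} {X : Set (Fin d → ℂ)} {f : Fin s → MvPolynomial (Fin d) ℂ}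
    (hf : Ideal.span (Set.range f) = MvPolynomial.vanishingIdeal ℂ X)
    {x : Fin d → ℂ} (hx : x ∈ X) :
    (jacobianMatrix f x).rank = Module.finrank ℂ (Submodule.span ℂ
      ((fun (g : MvPolynomial (Fin d) ℂ) (j : Fin d) =>
        MvPolynomial.eval x (MvPolynomial.pderiv j g)) ''
          (MvPolynomial.vanishingIdeal ℂ X : Set (MvPolynomial (Fin d) ℂ)))) := by
  rw [Matrix.rank_eq_finrank_span_row]
  have key : Submodule.span ℂ (Set.range (jacobianMatrix f x).row) = Submodule.span ℂ
      ((fun (g : MvPolynomial (Fin d) ℂ) (j : Fin d) =>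
        MvPolynomial.eval x (MvPolynomial.pderiv j g)) ''
          (MvPolynomial.vanishingIdeal ℂ X : Set (MvPolynomial (Fin d) ℂ))) := by
    apply le_antisymm
    · rw [Submodule.span_le]
      rintro _ ⟨i, rfl⟩
      refine Submodule.subset_span ⟨f i, ?_, rfl⟩
      rw [← hf]
      exact Ideal.subset_span ⟨i, rfl⟩
    · rw [Submodule.span_le]
      rintro _ ⟨g, hg, rfl⟩
      rw [SetLike.mem_coe, ← hf] at hg
      have hev : ∀ h ∈ Ideal.span (Set.range f), MvPolynomial.eval x h = 0 := by
        intro h hh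
        rw [hf] at hh
        simpa [MvPolynomial.aeval_eq_eval] using hh x hx
      induction hg using Submodule.span_induction with
      | mem g hg =>
        obtain ⟨i, rfl⟩ := hg
        exact Submodule.subset_span ⟨i, rfl⟩
      | zero =>
        refine SetLike.mem_coe.2 ?_
        convert Submodule.zero_mem _ using 1
        ext j
        simp
      | add p q _ _ hp hq =>
        refine SetLike.mem_coe.2 ?_
        convert Submodule.add_mem _ hp hq using 1
        ext j
        simp
      | smul a p hp' hp =>
        refine SetLike.mem_coe.2 ?_
        convert Submodule.smul_mem _ (MvPolynomial.eval x a) hp using 1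
        ext j
        simp [hev p hp']
  rw [key]

theorem isSmoothPoint_iff {d s : ℕ} {X : Set (Fin d → ℂ)} {f : Fin s → MvPolynomial (Fin d) ℂ}
    (hf : Ideal.span (Set.range f) = MvPolynomial.vanishingIdeal ℂ X) (x : Fin d → ℂ) :
    IsSmoothPoint X x ↔
      x ∈ X ∧ ∀ y ∈ X, (jacobianMatrix f y).rank ≤ (jacobianMatrix f x).rank := by
  refine ⟨?_, fun h => ⟨h.1, s, f, hf, h.2⟩⟩
  rintro ⟨hx, t, g, hg, h⟩
  refine ⟨hx, fun y hy => ?_⟩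
  have := h y hy
  rwa [rank_jacobianMatrix hg hy, rank_jacobianMatrix hg hx, ← rank_jacobianMatrix hf hy,
    ← rank_jacobianMatrix hf hx] at this

/-- The Zariski topology on `ℂ^d`: its closed sets are the varieties. -/
@[reducible] def zariskiTopology (d : ℕ) : TopologicalSpace (Fin d → ℂ) :=
  TopologicalSpace.ofClosed {X | IsVariety X}
    ⟨{1}, by ext x; simp [complexZeros]⟩
    (by
      intro A hA
      refine ⟨{f | ∀ x ∈ ⋂₀ A, MvPolynomial.eval x f = 0}, ?_⟩
      ext x
      refine ⟨fun hx f hf => hf x hx, fun hx X hX => ?_⟩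
      obtain ⟨S, hS⟩ := hA hX
      rw [hS]
      intro f hf
      refine hx f fun y hy => ?_
      have hyX := hy X hX
      rw [hS] at hyX
      exact hyX f hf)
    (by
      rintro X ⟨S, rfl⟩ Y ⟨T, rfl⟩
      refine ⟨{h | ∃ f ∈ S, ∃ g ∈ T, h = f * g}, ?_⟩
      ext x
      constructor
      · rintro (hx | hx) _ ⟨f, hf, g, hg, rfl⟩
        · simp [hx f hf]
        · simp [hx g hg]
      · intro hx
        by_contra hcon
        simp only [complexZeros, Set.mem_union, Set.mem_ofPred_eq, not_or, not_forall] at hcon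
        obtain ⟨⟨f, hf, hfx⟩, g, hg, hgx⟩ := hcon
        have h0 := hx (f * g) ⟨f, hf, g, hg, rfl⟩
        rw [map_mul] at h0
        exact (mul_ne_zero hfx hgx) h0)

/-- The closure of `U` in the Zariski topology of `ℂ^d`. -/
def zariskiClosure {d : ℕ} (U : Set (Fin d → ℂ)) : Set (Fin d → ℂ) :=
  @closure _ (zariskiTopology d) U

/-- The Zariski closure of `U` is `V(I(U))`. -/
theorem zariskiClosure_eq {d : ℕ} (U : Set (Fin d → ℂ)) :
    zariskiClosure U =
      complexZeros (MvPolynomial.vanishingIdeal ℂ U : Set (MvPolynomial (Fin d) ℂ)) := by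
  let _ := zariskiTopology d
  have hcl : ∀ X : Set (Fin d → ℂ), IsClosed X ↔ IsVariety X := fun X => by
    rw [← isOpen_compl_iff]
    change IsVariety Xᶜᶜ ↔ IsVariety X
    rw [compl_compl]
  apply Set.Subset.antisymm
  · refine closure_minimal ?_ ((hcl _).2 ⟨_, rfl⟩)
    intro x hx f hf
    simpa [MvPolynomial.aeval_eq_eval] using hf x hx
  · intro x hx
    obtain ⟨S, hS⟩ := (hcl (closure U)).1 isClosed_closure
    change x ∈ closure U
    rw [hS]
    intro f hf
    refine hx f fun y hy => ?_
    have hy' : y ∈ closure U := subset_closure hy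
    rw [hS] at hy'
    simpa [MvPolynomial.aeval_eq_eval] using hy' f hf

/-- `U` is a Zariski dense subset of `X`. -/
def IsZariskiDenseIn {d : ℕ} (U X : Set (Fin d → ℂ)) : Prop :=
  U ⊆ X ∧ X ⊆ zariskiClosure U

/-! Let I and N be the ideals of real polynomials vanishing on X and on X(ℝ), and m the maximal
ideal of the smooth real point q. Splitting into real and imaginary parts reduces the theorem to N ≤
I. Instead of a local parametrisation of X, the proof shows N ≤ I + mⁿ for every n and applies
Krull's intersection theorem in the domain ℝ[x]/I.

Real f₁, …, f_r ∈ I whose gradients span those of I near q yield polynomial vector fields D_l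
killing every f_i. These preserve I (`vectorFieldDerivation_mem_vanishingIdeal`), so their flows
keep real points on X, and hence they preserve N as well
(`MvPolynomial.eval_vectorFieldDerivation_eq_zero`). Put E = ∑ (X_l - q_l) D_l. Then E maps N into
mN, and it acts as 1 on m modulo I + m² (`MvPolynomial.eulerDerivation_sub_mem`), hence as n on mⁿ
modulo I + mⁿ⁺¹. If g ∈ N is congruent to e ∈ mⁿ modulo I, then E g ∈ mN ≤ I + mⁿ⁺¹ forces n e ∈ I +
mⁿ⁺¹, so g climbs one step (`Ideal.le_of_derivation`). -/

/-! ### Derivations and powers of an ideal. -/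

theorem Ideal.mul_sup_le_sup {R : Type*} [CommRing R] (I J L : Ideal R) :
    J * I ⊔ L ≤ I ⊔ L := by
  refine sup_le (le_sup_of_le_left ?_) le_sup_right
  exact Ideal.mul_le.2 fun _ _ _ h => I.mul_mem_left _ h

/-- By Leibniz, a derivation of weight 1 on m has weight n on mⁿ, just as the Euler field multiplies
forms of degree n by n. -/
theorem Derivation.sub_natCast_mul_mem_of_mem_pow {K R : Type*} [CommRing K] [CommRing R]
    [Algebra K R] {I m : Ideal R} (E : Derivation K R R)
    (hE : ∀ e ∈ m, E e - e ∈ I ⊔ m ^ 2) {n : ℕ} (hn : 1 ≤ n) :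
    ∀ e ∈ m ^ n, E e - n * e ∈ I ⊔ m ^ (n + 1) := by
  induction n, hn using Nat.le_induction with
  | base => simpa using hE
  | succ n _ ih =>
    intro e he
    rw [pow_succ] at he
    induction he using Submodule.mul_induction_on' with
    | mem_mul_mem a ha b hb =>
      have h1 : a * (E b - b) ∈ I ⊔ m ^ (n + 2) := by
        have := Ideal.mul_mem_mul ha (hE b hb)
        rw [Ideal.mul_sup, ← pow_add] at this
        exact Ideal.mul_sup_le_sup _ _ _ this
      have h2 : b * (E a - n * a) ∈ I ⊔ m ^ (n + 2) := by
        have := Ideal.mul_mem_mul (ih a ha) hb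
        rw [Ideal.sup_mul, ← pow_succ, mul_comm _ b, mul_comm I] at this
        exact Ideal.mul_sup_le_sup _ _ _ this
      have : E (a * b) - ((n + 1 : ℕ) : R) * (a * b) = a * (E b - b) + b * (E a - n * a) := by
        rw [Derivation.leibniz]
        push_cast
        simp only [smul_eq_mul]
        ring
      rw [this]
      exact add_mem h1 h2
    | add a _ b _ ha hb =>
      have : E (a + b) - ((n + 1 : ℕ) : R) * (a + b) =
        (E a - ((n + 1 : ℕ) : R) * a) + (E b - ((n + 1 : ℕ) : R) * b) := by
        rw [map_add]
        ring
      rw [this]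
      exact add_mem ha hb

/-- In a Noetherian ring, an ideal contained in `I + mⁿ` for all `n` is contained in the prime
ideal `I`, provided `I + m` is proper. -/
theorem Ideal.le_of_forall_le_sup_pow {R : Type*} [CommRing R] [IsNoetherianRing R]
    {I m N : Ideal R} [I.IsPrime] (hIm : I ⊔ m ≠ ⊤) (h : ∀ n : ℕ, N ≤ I ⊔ m ^ n) : N ≤ I := by
  intro g hg
  rw [← Ideal.Quotient.eq_zero_iff_mem]
  -- Krull's theorem in the domain R/I needs the image of m to be proper.
  have hne : m.map (Ideal.Quotient.mk I) ≠ ⊤ := by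
    intro htop
    apply hIm
    have := congrArg (Ideal.comap (Ideal.Quotient.mk I)) htop
    rwa [Ideal.comap_map_of_surjective _ Ideal.Quotient.mk_surjective, Ideal.comap_top,
      ← RingHom.ker_eq_comap_bot, Ideal.mk_ker, sup_comm] at this
  have hmem : Ideal.Quotient.mk I g ∈ ⨅ n : ℕ, m.map (Ideal.Quotient.mk I) ^ n := by
    rw [Ideal.mem_iInf]
    intro n
    have := Ideal.mem_map_of_mem (Ideal.Quotient.mk I) (h n hg)
    rwa [Ideal.map_sup, Ideal.map_quotient_self, bot_sup_eq, Ideal.map_pow] at this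
  rwa [Ideal.iInf_pow_eq_bot_of_isDomain _ hne] at hmem

/-- An ideal `N` contained in `I + m` and stable under a derivation that induces the
identity on `m / (I + m²)` and maps `N` to `m N` is contained in the prime ideal `I`. -/
theorem Ideal.le_of_derivation {K R : Type*} [Field K] [CharZero K] [CommRing R] [Algebra K R]
    [IsNoetherianRing R] {I m N : Ideal R} [I.IsPrime] (hIm : I ⊔ m ≠ ⊤) (hN : N ≤ I ⊔ m)
    (E : Derivation K R R) (hE : ∀ e ∈ m, E e - e ∈ I ⊔ m ^ 2) (hEI : ∀ g ∈ I, E g ∈ I)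
    (hEN : ∀ g ∈ N, E g ∈ m * N) : N ≤ I := by
  refine Ideal.le_of_forall_le_sup_pow hIm fun n => ?_
  rcases Nat.eq_zero_or_pos n with rfl | hn
  · simp
  induction n, hn using Nat.le_induction with
  | base => simpa using hN
  | succ n hn ih =>
    intro g hg
    obtain ⟨h, hh, e, he, rfl⟩ := Submodule.mem_sup.1 (ih hg)
    -- The extra factor m in E(N) ≤ mN raises the inductive bound by one power.
    have h1 : E (h + e) ∈ I ⊔ m ^ (n + 1) := by
      have := Ideal.mul_mono_right ih (hEN _ hg)
      rw [Ideal.mul_sup, ← pow_succ'] at this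
      exact Ideal.mul_sup_le_sup _ _ _ this
    have h2 := Derivation.sub_natCast_mul_mem_of_mem_pow E hE hn e he
    have h3 : E h ∈ I ⊔ m ^ (n + 1) := Ideal.mem_sup_left (hEI h hh)
    have h4 : (n : R) * e ∈ I ⊔ m ^ (n + 1) := by
      have : (n : R) * e = E (h + e) - E h - (E e - n * e) := by
        rw [map_add]
        ring
      rw [this]
      exact sub_mem (sub_mem h1 h3) h2
    -- Dividing by n uses characteristic zero and n ≥ 1, so the induction cannot start at 0.
    have h5 : e = algebraMap K R (n : K)⁻¹ * ((n : R) * e) := by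
      rw [← mul_assoc, ← map_natCast (algebraMap K R) n, ← map_mul, inv_mul_cancel₀, map_one,
        one_mul]
      exact Nat.cast_ne_zero.2 (by omega)
    refine add_mem (Ideal.mem_sup_left hh) ?_
    rw [h5]
    exact Ideal.mul_mem_left _ _ h4

/-! ### Flows of real polynomial vector fields. -/

namespace MvPolynomial

theorem hasDerivAt_eval_comp {σ : Type*} [Fintype σ] {γ : ℝ → σ → ℝ} {w : σ → ℝ} {t : ℝ}
    (hγ : HasDerivAt γ w t) (f : MvPolynomial σ ℝ) :
    HasDerivAt (fun u => eval (γ u) f) (∑ j, w j * eval (γ t) (pderiv j f)) t := by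
  classical
  induction f using MvPolynomial.induction_on with
  | C a => simpa using hasDerivAt_const t a
  | add p q hp hq =>
    simp only [map_add, mul_add, Finset.sum_add_distrib]
    exact hp.add hq
  | mul_X p i hp =>
    have := hp.mul (hasDerivAt_pi.1 hγ i)
    simp only [map_mul, eval_X]
    convert! this using 1
    simp only [Derivation.leibniz, pderiv_X, smul_eq_mul, map_add, map_mul, eval_X, mul_add,
      Finset.sum_add_distrib, Finset.sum_mul]
    rw [add_comm]
    congr 1
    · exact Finset.sum_congr rfl fun _ _ => by ring
    · rw [Finset.sum_eq_single i]
      · simp [mul_comm]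
      · intro j _ hj
        simp [Pi.single_eq_of_ne' hj]
      · simp

/-- The polynomial vector field `v`, as a derivation. -/
noncomputable def vectorFieldDerivation {σ : Type*} [Fintype σ] {k : Type*} [CommRing k]
    (v : σ → MvPolynomial σ k) : Derivation k (MvPolynomial σ k) (MvPolynomial σ k) :=
  ∑ j, v j • pderiv j

theorem vectorFieldDerivation_apply {σ : Type*} [Fintype σ] {k : Type*} [CommRing k]
    (v : σ → MvPolynomial σ k) (f : MvPolynomial σ k) :
    vectorFieldDerivation v f = ∑ j, v j * pderiv j f := by
  rw [vectorFieldDerivation, ← Derivation.coeFnAddMonoidHom_apply, map_sum, Finset.sum_apply]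
  rfl

theorem exists_hasDerivAt_eval {σ : Type*} [Fintype σ] (v : σ → MvPolynomial σ ℝ) (q : σ → ℝ) :
    ∃ γ : ℝ → σ → ℝ, γ 0 = q ∧ ∃ ε > (0 : ℝ), ∀ t ∈ Set.Icc 0 ε,
      HasDerivAt γ (fun j => eval (γ t) (v j)) t := by
  have hv : ContDiffAt ℝ 1 (fun x j => eval x (v j)) q := by
    exact contDiffAt_pi.2 fun j =>
      ((AnalyticOnNhd.eval_mvPolynomial (𝕜 := ℝ) (v j)) q (Set.mem_univ q)).contDiffAt
  obtain ⟨γ, hγ0, ε, hε, h⟩ :=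
    ContDiffAt.exists_forall_mem_closedBall_exists_eq_forall_mem_Ioo_hasDerivAt₀ hv 0
  refine ⟨γ, hγ0, ε / 2, by positivity, fun t ht => ?_⟩
  exact h t ⟨by linarith [ht.1], by linarith [ht.2]⟩

/-- A polynomial vector field preserving the ideal `J` is tangent to the real zero set of `J`. -/
theorem eval_vectorFieldDerivation_eq_zero {σ : Type*} [Fintype σ] {v : σ → MvPolynomial σ ℝ}
    {J : Ideal (MvPolynomial σ ℝ)} (hJ : ∀ g ∈ J, vectorFieldDerivation v g ∈ J)
    {f : MvPolynomial σ ℝ} (hf : ∀ x, (∀ g ∈ J, eval x g = 0) → eval x f = 0)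
    {q : σ → ℝ} (hq : ∀ g ∈ J, eval q g = 0) : eval q (vectorFieldDerivation v f) = 0 := by
  obtain ⟨γ, hγ0, ε, hε, hγ⟩ := exists_hasDerivAt_eval v q
  have hder : ∀ t ∈ Set.Icc 0 ε, ∀ g : MvPolynomial σ ℝ,
      HasDerivAt (fun u => eval (γ u) g) (eval (γ t) (vectorFieldDerivation v g)) t := by
    intro t ht g
    have := hasDerivAt_eval_comp (hγ t ht) g
    simpa [vectorFieldDerivation_apply] using this
  obtain ⟨s, gen, hgen⟩ := Submodule.fg_iff_exists_fin_generating_family.1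
    ((isNoetherianRing_iff_ideal_fg _).1 inferInstance J)
  have hA : ∀ i, ∃ a : Fin s → MvPolynomial σ ℝ,
      ∑ k, a k * gen k = vectorFieldDerivation v (gen i) := by
    intro i
    have : vectorFieldDerivation v (gen i) ∈ Submodule.span (MvPolynomial σ ℝ) (Set.range gen) := by
      rw [hgen]
      exact hJ _ (hgen ▸ Submodule.subset_span ⟨i, rfl⟩)
    simpa using (Submodule.mem_span_range_iff_exists_fun (MvPolynomial σ ℝ)).1 this
  choose a ha using hA
  have hγc : ContinuousOn γ (Set.Icc 0 ε) := fun t ht => (hγ t ht).continuousAt.continuousWithinAt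
  have hpc : ∀ g : MvPolynomial σ ℝ, ContinuousOn (fun t => eval (γ t) g) (Set.Icc 0 ε) :=
    fun g t ht => (hder t ht g).continuousAt.continuousWithinAt
  have hbd : ∀ i k, ∃ C, ∀ t ∈ Set.Icc 0 ε, ‖eval (γ t) (a i k)‖ ≤ C := fun i k =>
    isCompact_Icc.exists_bound_of_continuousOn (hpc _)
  choose C hC using hbd
  -- Along the integral curve the generators of J satisfy a linear system with bounded coefficients
  -- a i k and zero initial value, so they vanish by Grönwall.
  have hzero : ∀ t ∈ Set.Icc 0 ε, (fun i => eval (γ t) (gen i)) = 0 := by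
    refine eq_zero_of_abs_deriv_le_mul_abs_self_of_eq_zero_right
      (f' := fun t i => eval (γ t) (vectorFieldDerivation v (gen i)))
      (K := ∑ i, ∑ k, |C i k|) (continuousOn_pi.2 fun i => hpc _) ?_ ?_ ?_
    · intro t ht
      exact (hasDerivAt_pi.2 fun i => hder t ⟨ht.1, ht.2.le⟩ (gen i)).hasDerivWithinAt
    · ext i
      simpa [hγ0] using hq _ (hgen ▸ Submodule.subset_span ⟨i, rfl⟩)
    · intro t ht
      have ht' : t ∈ Set.Icc 0 ε := ⟨ht.1, ht.2.le⟩
      rw [pi_norm_le_iff_of_nonneg (by positivity)]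
      intro i
      rw [← ha i, map_sum]
      refine (norm_sum_le _ _).trans ?_
      calc ∑ k, ‖eval (γ t) (a i k * gen k)‖
          ≤ ∑ k, |C i k| * ‖fun i => eval (γ t) (gen i)‖ := by
            refine Finset.sum_le_sum fun k _ => ?_
            rw [map_mul, norm_mul]
            exact mul_le_mul ((hC i k t ht').trans (le_abs_self _))
              (norm_le_pi_norm (fun i => eval (γ t) (gen i)) k) (norm_nonneg _) (abs_nonneg _)
        _ = (∑ k, |C i k|) * ‖fun i => eval (γ t) (gen i)‖ := by rw [Finset.sum_mul]
        _ ≤ _ := by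
            refine mul_le_mul_of_nonneg_right ?_ (norm_nonneg _)
            exact Finset.single_le_sum (f := fun i => ∑ k, |C i k|)
              (fun i _ => Finset.sum_nonneg fun k _ => abs_nonneg _) (Finset.mem_univ i)
  have hfz : ∀ t ∈ Set.Icc 0 ε, eval (γ t) f = 0 := by
    intro t ht
    refine hf _ fun g hg => ?_
    rw [← hgen] at hg
    obtain ⟨c, rfl⟩ := (Submodule.mem_span_range_iff_exists_fun _).1 hg
    rw [map_sum]
    refine Finset.sum_eq_zero fun i _ => ?_
    rw [smul_eq_mul, map_mul, congrFun (hzero t ht) i]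
    simp
  have h0 : (0 : ℝ) ∈ Set.Icc 0 ε := ⟨le_rfl, hε.le⟩
  have h1 := (hder 0 h0 f).hasDerivWithinAt (s := Set.Icc 0 ε)
  -- The vanishing is known only for t ≥ 0; one-sided derivatives at the endpoint 0 suffice.
  have h2 : HasDerivWithinAt (fun u => eval (γ u) f) 0 (Set.Icc 0 ε) 0 :=
    (hasDerivWithinAt_const 0 (Set.Icc 0 ε) (0 : ℝ)).congr hfz (hfz 0 h0)
  rw [← hγ0]
  exact (uniqueDiffOn_Icc hε 0 h0).eq_deriv _ h1 h2

end MvPolynomial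

/-- Independent rows make the map surjective. A right inverse B of the Jacobian A gives the
projector 1 - B A onto its kernel, the tangent space. -/
theorem Matrix.exists_mul_eq_one_of_linearIndependent_row {m n K : Type*} [Fintype m] [Fintype n]
    [DecidableEq m] [Field K] {A : Matrix m n K} (hA : LinearIndependent K A.row) :
    ∃ B : Matrix n m K, A * B = 1 := by
  classical
  have hrange : LinearMap.range A.mulVecLin = ⊤ := by
    apply Submodule.eq_top_of_finrank_eq
    rw [Module.finrank_fintype_fun_eq_card]
    exact hA.rank_matrix
  obtain ⟨g, hg⟩ := A.mulVecLin.exists_rightInverse_of_surjective hrange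
  refine ⟨LinearMap.toMatrix' g, ?_⟩
  have := congrArg LinearMap.toMatrix' hg
  rwa [LinearMap.toMatrix'_comp, LinearMap.toMatrix'_id, ← Matrix.toLin'_apply',
    LinearMap.toMatrix'_toLin'] at this

/-! ### Real and imaginary parts, and real frames at smooth points. -/

namespace MvPolynomial

variable {σ : Type*}

theorem eval_map_ofReal (x : σ → ℂ) (g : MvPolynomial σ ℝ) :
    eval x (map (algebraMap ℝ ℂ) g) = aeval x g := by
  rw [eval_map, aeval_def]

theorem aeval_ofReal (q : σ → ℝ) (g : MvPolynomial σ ℝ) :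
    aeval (fun i => (q i : ℂ)) g = (eval q g : ℂ) := by
  have := aeval_algebraMap_apply (A := ℝ) ℂ q g
  rw [aeval_eq_eval] at this
  exact this

theorem aeval_star (x : σ → ℂ) (g : MvPolynomial σ ℝ) :
    aeval (star x) g = star (aeval x g) :=
  (comp_aeval_apply (f := x) Complex.conjAe.toAlgHom g).symm

theorem exists_eq_map_add_I_mul_map (f : MvPolynomial σ ℂ) : ∃ a b : MvPolynomial σ ℝ,
    f = map (algebraMap ℝ ℂ) a + C Complex.I * map (algebraMap ℝ ℂ) b := by
  induction f using MvPolynomial.induction_on with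
  | C z =>
    refine ⟨C z.re, C z.im, ?_⟩
    rw [map_C, map_C, ← C_mul, ← C_add]
    congr 1
    rw [mul_comm]
    exact (Complex.re_add_im z).symm
  | add p q hp hq =>
    obtain ⟨a, b, rfl⟩ := hp
    obtain ⟨a', b', rfl⟩ := hq
    exact ⟨a + a', b + b', by rw [map_add, map_add]; ring⟩
  | mul_X p i hp =>
    obtain ⟨a, b, rfl⟩ := hp
    exact ⟨a * X i, b * X i, by rw [map_mul, map_mul, map_X]; ring⟩

/-- Real and imaginary parts of a polynomial vanishing on a conjugation invariant set vanish
on that set. -/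
theorem mem_vanishingIdeal_of_map_add_I_mul_map {Y : Set (σ → ℂ)} (hY : ∀ x ∈ Y, star x ∈ Y)
    {a b : MvPolynomial σ ℝ}
    (h : ∀ x ∈ Y, eval x (map (algebraMap ℝ ℂ) a + C Complex.I * map (algebraMap ℝ ℂ) b) = 0) :
    a ∈ vanishingIdeal ℝ Y ∧ b ∈ vanishingIdeal ℝ Y := by
  have key : ∀ x ∈ Y, aeval x a = 0 ∧ aeval x b = 0 := by
    intro x hx
    have h1 := h x hx
    have h2 := h _ (hY x hx)
    simp only [map_add, map_mul, eval_C, eval_map_ofReal, aeval_star] at h1 h2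
    -- Conjugating the equation at `star x` gives a(x) - i b(x) = 0, to be combined with a(x) + i
    -- b(x) = 0.
    have h3 := congrArg star h2
    simp only [star_add, star_mul', star_star, star_zero] at h3
    rw [Complex.star_def, Complex.conj_I] at h3
    constructor
    · linear_combination (h1 + h3) / 2
    · have : Complex.I * aeval x b = 0 := by linear_combination (h1 - h3) / 2
      simpa using this
  exact ⟨fun x hx => (key x hx).1, fun x hx => (key x hx).2⟩

/-- The gradient of a real polynomial at a complex point. -/
noncomputable def complexGradient (y : σ → ℂ) (g : MvPolynomial σ ℝ) : σ → ℂ :=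
  fun j => aeval y (pderiv j g)

end MvPolynomial

open MvPolynomial in
/-- At each point of a conjugation invariant set, the gradients of all complex polynomials
vanishing on the set are spanned by those of the real ones. -/
theorem span_gradient_eq {d : ℕ} {X : Set (Fin d → ℂ)} (hX : ∀ x ∈ X, star x ∈ X)
    (y : Fin d → ℂ) :
    Submodule.span ℂ ((fun (g : MvPolynomial (Fin d) ℂ) (j : Fin d) => eval y (pderiv j g)) ''
      (vanishingIdeal ℂ X : Set (MvPolynomial (Fin d) ℂ))) =
    Submodule.span ℂ (complexGradient y '' (vanishingIdeal ℝ X : Set (MvPolynomial (Fin d) ℝ))) := by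
  have hmap : ∀ (g : MvPolynomial (Fin d) ℝ) j,
      eval y (pderiv j (map (algebraMap ℝ ℂ) g)) = complexGradient y g j := by
    intro g j
    rw [pderiv_map, eval_map_ofReal, complexGradient]
  apply le_antisymm <;> rw [Submodule.span_le]
  · rintro _ ⟨g, hg, rfl⟩
    obtain ⟨a, b, rfl⟩ := exists_eq_map_add_I_mul_map g
    obtain ⟨ha, hb⟩ := mem_vanishingIdeal_of_map_add_I_mul_map hX (a := a) (b := b)
      fun x hx => by simpa [aeval_eq_eval] using hg x hx
    have : (fun j => eval y (pderiv j (map (algebraMap ℝ ℂ) a +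
        C Complex.I * map (algebraMap ℝ ℂ) b))) =
        complexGradient y a + Complex.I • complexGradient y b := by
      ext j
      simp [hmap]
    simp only [this]
    exact add_mem (Submodule.subset_span ⟨a, ha, rfl⟩)
      (Submodule.smul_mem _ _ (Submodule.subset_span ⟨b, hb, rfl⟩))
  · rintro _ ⟨g, hg, rfl⟩
    rw [show complexGradient y g = fun j => eval y (pderiv j (map (algebraMap ℝ ℂ) g)) from
      (funext (hmap g)).symm]
    refine Submodule.subset_span (Set.mem_image_of_mem _ ?_)
    intro x hx
    rw [aeval_eq_eval]
    exact (eval_map_ofReal x g).trans (hg x hx)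

open MvPolynomial in
/-- Near a smooth point, the gradients of all elements of the ideal are spanned by those of
finitely many real ones. -/
theorem IsSmoothPoint.exists_real_frame {d : ℕ} {X : Set (Fin d → ℂ)}
    (hX : ∀ x ∈ X, star x ∈ X) {x : Fin d → ℂ} (hx : IsSmoothPoint X x) :
    ∃ (r : ℕ) (f : Fin r → MvPolynomial (Fin d) ℝ), (∀ i, f i ∈ vanishingIdeal ℝ X) ∧
      LinearIndependent ℂ (fun i => complexGradient x (f i)) ∧
      ∀ y ∈ X, LinearIndependent ℂ (fun i => complexGradient y (f i)) →
        ∀ g ∈ vanishingIdeal ℝ X,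
          complexGradient y g ∈ Submodule.span ℂ (Set.range fun i => complexGradient y (f i)) := by
  obtain ⟨hxX, s, gen, hgen, hmax⟩ := hx
  have hrank : ∀ y ∈ X, (jacobianMatrix gen y).rank = Module.finrank ℂ (Submodule.span ℂ
      (complexGradient y '' (vanishingIdeal ℝ X : Set (MvPolynomial (Fin d) ℝ)))) := by
    intro y hy
    rw [rank_jacobianMatrix hgen hy, span_gradient_eq hX]
  -- A basis of the span at x can be picked among the gradients themselves; its size is the rank at
  -- x.
  obtain ⟨v, hv, -, hli⟩ := Submodule.exists_fun_fin_finrank_span_eq ℂ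
    (complexGradient x '' (vanishingIdeal ℝ X : Set (MvPolynomial (Fin d) ℝ)))
  choose f hf hfv using hv
  refine ⟨_, f, hf, ?_, fun y hy hliy g hg => ?_⟩
  · simpa only [hfv] using hli
  have hle : Submodule.span ℂ (Set.range fun i => complexGradient y (f i)) ≤
      Submodule.span ℂ
        (complexGradient y '' (vanishingIdeal ℝ X : Set (MvPolynomial (Fin d) ℝ))) := by
    apply Submodule.span_mono
    rintro _ ⟨i, rfl⟩
    exact ⟨f i, hf i, rfl⟩
  -- Independence at y already gives the subspace the dimension found at x, which by smoothness
  -- bounds the dimension at y.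
  have heq := Submodule.eq_of_le_of_finrank_le hle (by
    rw [finrank_span_eq_card hliy, Fintype.card_fin, ← hrank y hy, ← hrank x hxX]
    exact hmax y hy)
  rw [heq]
  exact Submodule.subset_span ⟨g, hg, rfl⟩

theorem IsDefinedByRealPolynomials.star_mem {d : ℕ} {X : Set (Fin d → ℂ)}
    (hX : IsDefinedByRealPolynomials X) : ∀ x ∈ X, star x ∈ X := by
  obtain ⟨S, rfl⟩ := hX
  intro x hx f hf
  rw [MvPolynomial.aeval_star, hx f hf, star_zero]

open MvPolynomial in
theorem IsDefinedByRealPolynomials.mem_of_forall_mem_vanishingIdeal {d : ℕ}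
    {X : Set (Fin d → ℂ)} (hX : IsDefinedByRealPolynomials X) {x : Fin d → ℂ}
    (hx : ∀ g ∈ vanishingIdeal ℝ X, aeval x g = 0) : x ∈ X := by
  obtain ⟨S, rfl⟩ := hX
  exact fun f hf => hx f fun y hy => hy f hf

-- A product in the ideal cuts X into two complex subvarieties, so irreducibility over ℂ makes the
-- real ideal prime; a point of X makes it proper.
open MvPolynomial in
theorem IsIrreducibleVariety.isPrime_vanishingIdeal {d : ℕ} {X : Set (Fin d → ℂ)}
    (hX : IsIrreducibleVariety X) (hne : X.Nonempty) : (vanishingIdeal ℝ X).IsPrime := by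
  refine ⟨?_, ?_⟩
  · obtain ⟨x, hx⟩ := hne
    intro h
    have : (1 : MvPolynomial (Fin d) ℝ) ∈ vanishingIdeal ℝ X := h ▸ Submodule.mem_top
    simpa using this x hx
  · intro a b hab
    obtain ⟨⟨S, hS⟩, hirr⟩ := hX
    have hvar : ∀ c : MvPolynomial (Fin d) ℝ, IsVariety {x ∈ X | aeval x c = 0} := by
      intro c
      refine ⟨insert (map (algebraMap ℝ ℂ) c) S, ?_⟩
      ext x
      simp only [hS, complexZeros, Set.mem_ofPred_eq, Set.forall_mem_insert, eval_map_ofReal,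
        and_comm]
    have hsplit : X = {x ∈ X | aeval x a = 0} ∪ {x ∈ X | aeval x b = 0} := by
      ext x
      refine ⟨fun hx => ?_, fun hx => hx.elim And.left And.left⟩
      have := hab x hx
      rw [map_mul, mul_eq_zero] at this
      exact this.imp (fun h => ⟨hx, h⟩) fun h => ⟨hx, h⟩
    rcases hirr _ _ (hvar a) (hvar b) hsplit with h | h
    · exact Or.inl fun x hx => (h ▸ hx : x ∈ {x ∈ X | aeval x a = 0}).2
    · exact Or.inr fun x hx => (h ▸ hx : x ∈ {x ∈ X | aeval x b = 0}).2

/-! ### Taylor expansion at a point and the Euler derivation. -/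

namespace MvPolynomial

variable {σ k : Type*} [CommRing k]

/-- The ideal generated by the linear forms `Xⱼ - pⱼ`. -/
noncomputable def pointIdeal (p : σ → k) : Ideal (MvPolynomial σ k) :=
  Ideal.span (Set.range fun j => X j - C (p j))

theorem X_sub_C_mem_pointIdeal (p : σ → k) (j : σ) : X j - C (p j) ∈ pointIdeal p :=
  Ideal.subset_span ⟨j, rfl⟩

theorem eval_eq_zero_of_mem_pointIdeal {p : σ → k} {g : MvPolynomial σ k}
    (hg : g ∈ pointIdeal p) : eval p g = 0 := by
  have : pointIdeal p ≤ RingHom.ker (eval p) := by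
    rw [pointIdeal, Ideal.span_le]
    rintro _ ⟨j, rfl⟩
    simp [RingHom.mem_ker]
  exact this hg

/-- First order Taylor expansion at a point. -/
theorem sub_taylor_mem_pointIdeal_sq [Fintype σ] (p : σ → k) (g : MvPolynomial σ k) :
    g - C (eval p g) - ∑ j, C (eval p (pderiv j g)) * (X j - C (p j)) ∈ pointIdeal p ^ 2 := by
  classical
  induction g using MvPolynomial.induction_on with
  | C a => simp
  | add f g hf hg =>
    convert! add_mem hf hg using 1
    simp only [map_add, add_mul, Finset.sum_add_distrib]
    ring
  | mul_X f i hf =>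
    have hL : ∑ j, C (eval p (pderiv j f)) * (X j - C (p j)) ∈ pointIdeal p :=
      sum_mem fun j _ => Ideal.mul_mem_left _ _ (X_sub_C_mem_pointIdeal p j)
    have h1 := Ideal.mul_mem_mul hL (X_sub_C_mem_pointIdeal p i)
    rw [← sq] at h1
    convert! add_mem h1 (Ideal.mul_mem_right (X i) _ hf) using 1
    have hsum : ∑ j, C (eval p (pderiv j (f * X i))) * (X j - C (p j)) =
        C (eval p f) * (X i - C (p i)) +
          C (p i) * ∑ j, C (eval p (pderiv j f)) * (X j - C (p j)) := by
      rw [Finset.mul_sum]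
      simp only [Derivation.leibniz, pderiv_X, smul_eq_mul, map_add, map_mul, eval_X, add_mul,
        Finset.sum_add_distrib]
      congr 1
      · rw [Finset.sum_eq_single i]
        · simp
        · intro j _ hj
          simp [Pi.single_eq_of_ne' hj]
        · simp
      · exact Finset.sum_congr rfl fun _ _ => by ring
    rw [hsum, map_mul, map_mul, eval_X]
    ring

theorem sub_C_eval_mem_pointIdeal [Fintype σ] (p : σ → k) (g : MvPolynomial σ k) :
    g - C (eval p g) ∈ pointIdeal p := by
  have h := Ideal.pow_le_self two_ne_zero (sub_taylor_mem_pointIdeal_sq p g)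
  have hL : ∑ j, C (eval p (pderiv j g)) * (X j - C (p j)) ∈ pointIdeal p :=
    sum_mem fun j _ => Ideal.mul_mem_left _ _ (X_sub_C_mem_pointIdeal p j)
  simpa using add_mem h hL

theorem mem_pointIdeal_iff [Fintype σ] {p : σ → k} {g : MvPolynomial σ k} :
    g ∈ pointIdeal p ↔ eval p g = 0 := by
  refine ⟨eval_eq_zero_of_mem_pointIdeal, fun h => ?_⟩
  simpa [h] using sub_C_eval_mem_pointIdeal p g

/-- The Euler type derivation `∑ₗ (Xₗ - pₗ) Dₗ` of a family of vector fields, given by the columns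
of `V`. -/
noncomputable def eulerDerivation [Fintype σ] (p : σ → k) (V : Matrix σ σ (MvPolynomial σ k)) :
    Derivation k (MvPolynomial σ k) (MvPolynomial σ k) :=
  ∑ l, (X l - C (p l)) • vectorFieldDerivation fun j => V j l

theorem eulerDerivation_apply [Fintype σ] (p : σ → k) (V : Matrix σ σ (MvPolynomial σ k))
    (g : MvPolynomial σ k) :
    eulerDerivation p V g = ∑ l, (X l - C (p l)) * vectorFieldDerivation (fun j => V j l) g := by
  rw [eulerDerivation, ← Derivation.coeFnAddMonoidHom_apply, map_sum, Finset.sum_apply]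
  rfl

/-- If, at `p`, the matrix of vector fields is a projector along directions on which the linear
parts of elements of `I` are coordinates, then the Euler derivation is the identity on
`m / (I + m²)`. -/
theorem eulerDerivation_sub_mem [Fintype σ] [DecidableEq σ] {ι : Type*} [Fintype ι] (p : σ → k)
    (V : Matrix σ σ (MvPolynomial σ k)) {I : Ideal (MvPolynomial σ k)} (hI : I ≤ pointIdeal p)
    {f : ι → MvPolynomial σ k} (hf : ∀ i, f i ∈ I) (B : Matrix σ ι k)
    (hV : V.map (eval p) = 1 - B * Matrix.of fun i j => eval p (pderiv j (f i))) :
    ∀ e ∈ pointIdeal p, eulerDerivation p V e - e ∈ I ⊔ pointIdeal p ^ 2 := by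
  intro e he
  have hEm : ∀ a, eulerDerivation p V a ∈ pointIdeal p := by
    intro a
    rw [eulerDerivation_apply]
    exact sum_mem fun l _ => Ideal.mul_mem_right _ _ (X_sub_C_mem_pointIdeal p l)
  induction he using Submodule.span_induction with
  | zero => simp
  | add a b _ _ ha hb =>
    convert! add_mem ha hb using 1
    rw [map_add]
    ring
  -- Leibniz leaves the error e · E a, which lies in m² because E sends every polynomial into m.
  | smul a e he ih =>
    have h1 : e * eulerDerivation p V a ∈ pointIdeal p ^ 2 := by
      rw [sq]
      exact Ideal.mul_mem_mul he (hEm a)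
    convert! add_mem (Ideal.mul_mem_left _ a ih) (Ideal.mem_sup_right h1) using 1
    rw [smul_eq_mul, Derivation.leibniz, smul_eq_mul, smul_eq_mul]
    ring
  | mem e he =>
    obtain ⟨j, rfl⟩ := he
    set u : σ → MvPolynomial σ k := fun l => X l - C (p l) with hu
    have hval : eulerDerivation p V (X j - C (p j)) = ∑ l, u l * V j l := by
      rw [eulerDerivation_apply]
      refine Finset.sum_congr rfl fun l _ => ?_
      rw [vectorFieldDerivation_apply, Finset.sum_eq_single j]
      · simp [hu]
      · intro i _ hi
        simp [pderiv_X, Pi.single_eq_of_ne' hi]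
      · simp
    have hVjl : ∀ l, eval p (V j l) =
        (1 : Matrix σ σ k) j l - ∑ i, B j i * eval p (pderiv l (f i)) := by
      intro l
      have := congrFun (congrFun hV j) l
      simpa [Matrix.mul_apply] using this
    have h1 : ∑ l, u l * (V j l - C (eval p (V j l))) ∈ pointIdeal p ^ 2 := by
      rw [sq]
      exact sum_mem fun l _ => Ideal.mul_mem_mul (X_sub_C_mem_pointIdeal p l)
        (sub_C_eval_mem_pointIdeal p _)
    -- As f i vanishes at p, it agrees with its linear part modulo m². The linear forms removed by
    -- the projector therefore lie in I + m².
    have h2 : ∑ i, C (B j i) * (f i - ∑ l, C (eval p (pderiv l (f i))) * u l) ∈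
        pointIdeal p ^ 2 := by
      refine sum_mem fun i _ => Ideal.mul_mem_left _ _ ?_
      have := sub_taylor_mem_pointIdeal_sq p (f i)
      rwa [eval_eq_zero_of_mem_pointIdeal (hI (hf i)), C_0, sub_zero] at this
    have h3 : ∑ i, C (B j i) * f i ∈ I := sum_mem fun i _ => Ideal.mul_mem_left _ _ (hf i)
    have hlin : ∑ l, u l * C (eval p (V j l)) =
        u j - ∑ i, C (B j i) * ∑ l, C (eval p (pderiv l (f i))) * u l := by
      simp only [hVjl, C_sub, mul_sub, Finset.sum_sub_distrib]
      congr 1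
      · rw [Finset.sum_eq_single j]
        · simp
        · intro l _ hl
          simp [Matrix.one_apply_ne' hl]
        · simp
      · simp only [map_sum, Finset.mul_sum, C_mul]
        rw [Finset.sum_comm]
        exact Finset.sum_congr rfl fun _ _ => Finset.sum_congr rfl fun _ _ => by ring
    have : eulerDerivation p V (X j - C (p j)) - (X j - C (p j)) =
        ∑ l, u l * (V j l - C (eval p (V j l))) - ∑ i, C (B j i) * f i +
          ∑ i, C (B j i) * (f i - ∑ l, C (eval p (pderiv l (f i))) * u l) := by
      rw [hval]
      simp only [mul_sub, Finset.sum_sub_distrib] at hlin ⊢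
      rw [hlin]
      simp only [hu]
      ring
    rw [this]
    exact add_mem (sub_mem (Ideal.mem_sup_right h1) (Ideal.mem_sup_left h3))
      (Ideal.mem_sup_right h2)

end MvPolynomial

/-! ### Tangent vector fields of a frame, and the conclusion. -/

open MvPolynomial

/-- Columns of `V` are vector fields annihilating all functions with Jacobian matrix `F`; where
`F B` is invertible they span the common kernel of the rows of `F`. -/
noncomputable def tangentFields {R m n : Type*} [CommRing R] [Fintype m] [Fintype n] [DecidableEq m]
    [DecidableEq n] (F : Matrix m n R) (B : Matrix n m R) : Matrix n n R :=
  (F * B).det • (1 : Matrix n n R) - B * (F * B).adjugate * F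

/-- The adjugate replaces the inverse of F B, so the projector is cleared of denominators and the
fields stay polynomial. -/
theorem mul_tangentFields {R m n : Type*} [CommRing R] [Fintype m] [Fintype n] [DecidableEq m]
    [DecidableEq n] (F : Matrix m n R) (B : Matrix n m R) : F * tangentFields F B = 0 := by
  rw [tangentFields, Matrix.mul_sub, ← Matrix.mul_assoc, ← Matrix.mul_assoc,
    Matrix.mul_adjugate]
  simp

theorem map_tangentFields {R S m n : Type*} [CommRing R] [CommRing S] [Fintype m] [Fintype n]
    [DecidableEq m] [DecidableEq n] (φ : R →+* S) (F : Matrix m n R) (B : Matrix n m R) :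
    (tangentFields F B).map φ = tangentFields (F.map φ) (B.map φ) := by
  have h := (RingHom.map_adjugate φ (F * B)).symm
  have h' := (RingHom.map_det φ (F * B)).symm
  simp only [RingHom.mapMatrix_apply, Matrix.map_mul] at h h'
  rw [tangentFields, tangentFields, Matrix.map_sub φ (map_sub φ), Matrix.map_mul, Matrix.map_mul,
    h, h', Matrix.map_smul' φ _ _ (map_mul φ)]
  simp

/-- A vector field killing a frame of the ideal of `X` preserves this ideal. -/
theorem vectorFieldDerivation_mem_vanishingIdeal {d r : ℕ} {X : Set (Fin d → ℂ)}
    [(vanishingIdeal ℝ X).IsPrime] {f : Fin r → MvPolynomial (Fin d) ℝ}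
    (hframe : ∀ y ∈ X, LinearIndependent ℂ (fun i => complexGradient y (f i)) →
      ∀ g ∈ vanishingIdeal ℝ X,
        complexGradient y g ∈ Submodule.span ℂ (Set.range fun i => complexGradient y (f i)))
    {Δ : MvPolynomial (Fin d) ℝ} (hΔ : Δ ∉ vanishingIdeal ℝ X)
    (hΔf : ∀ y ∈ X, aeval y Δ ≠ 0 → LinearIndependent ℂ (fun i => complexGradient y (f i)))
    {v : Fin d → MvPolynomial (Fin d) ℝ} (hv : ∀ i, vectorFieldDerivation v (f i) = 0)
    {g : MvPolynomial (Fin d) ℝ} (hg : g ∈ vanishingIdeal ℝ X) :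
    vectorFieldDerivation v g ∈ vanishingIdeal ℝ X := by
  have hD : ∀ (y : Fin d → ℂ) h, aeval y (vectorFieldDerivation v h) =
      (fun j => aeval y (v j)) ⬝ᵥ complexGradient y h := by
    intro y h
    simp [vectorFieldDerivation_apply, dotProduct, complexGradient]
  -- The frame spans the gradients only where Δ ≠ 0; the factor Δ covers the rest of X and is
  -- cancelled by primality.
  have hmul : Δ * vectorFieldDerivation v g ∈ vanishingIdeal ℝ X := by
    intro y hy
    rw [map_mul]
    by_cases h0 : aeval y Δ = 0
    · rw [h0, zero_mul]
    obtain ⟨c, hc⟩ := (Submodule.mem_span_range_iff_exists_fun ℂ).1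
      (hframe y hy (hΔf y hy h0) g hg)
    rw [hD, ← hc, dotProduct_sum, Finset.sum_eq_zero, mul_zero]
    intro i _
    rw [dotProduct_smul, ← hD, hv i, map_zero, smul_zero]
  exact (Ideal.IsPrime.mem_or_mem inferInstance hmul).resolve_left hΔ

theorem IsSmoothPoint.vanishingIdeal_realPoints_le {d : ℕ} {X : Set (Fin d → ℂ)}
    (hirr : IsIrreducibleVariety X) (hreal : IsDefinedByRealPolynomials X) {p : Fin d → ℂ}
    (hp : p ∈ realPoints X) (hsm : IsSmoothPoint X p) :
    vanishingIdeal ℝ (realPoints X) ≤ vanishingIdeal ℝ X := by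
  obtain ⟨r, f, hfI, hli, hframe⟩ := hsm.exists_real_frame hreal.star_mem
  obtain ⟨hpX, q, rfl⟩ := id hp
  have hprime : (vanishingIdeal ℝ X).IsPrime := hirr.isPrime_vanishingIdeal ⟨_, hpX⟩
  let F : Matrix (Fin r) (Fin d) (MvPolynomial (Fin d) ℝ) := Matrix.of fun i j => pderiv j (f i)
  have hliR : LinearIndependent ℝ (F.map (eval q)).row := by
    have h := hli.restrict_scalars (R := ℝ) fun a b hab => by simpa using hab
    refine LinearIndependent.of_comp ((Algebra.linearMap ℝ ℂ).compLeft (Fin d)) ?_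
    convert! h using 1
    ext i j
    exact (aeval_ofReal q _).symm
  obtain ⟨B, hB⟩ := Matrix.exists_mul_eq_one_of_linearIndependent_row hliR
  -- Lifting B to constant polynomials makes det(F B') equal to 1 at q, so it is not in the ideal of
  -- X.
  obtain ⟨B', hBq⟩ : ∃ B' : Matrix (Fin d) (Fin r) (MvPolynomial (Fin d) ℝ),
      B'.map (eval q) = B := ⟨B.map (C : ℝ →+* MvPolynomial (Fin d) ℝ), by ext i j; simp⟩
  let V := tangentFields F B'
  have hqX : ∀ g ∈ vanishingIdeal ℝ X, eval q g = 0 := by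
    intro g hg
    have := hg _ hpX
    rw [aeval_ofReal] at this
    exact_mod_cast this
  have hdet : eval q (F * B').det = 1 := by
    rw [RingHom.map_det, RingHom.mapMatrix_apply, Matrix.map_mul, hBq, hB, Matrix.det_one]
  have hVq : V.map (eval q) = 1 - B * Matrix.of fun i j => eval q (pderiv j (f i)) := by
    rw [map_tangentFields, hBq, tangentFields, hB, Matrix.det_one, one_smul, Matrix.adjugate_one,
      Matrix.mul_one]
    rfl
  have hΔf : ∀ y ∈ X, aeval y (F * B').det ≠ 0 →
      LinearIndependent ℂ (fun i => complexGradient y (f i)) := by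
    intro y _ hy
    let φ : MvPolynomial (Fin d) ℝ →+* ℂ := (aeval y : MvPolynomial (Fin d) ℝ →ₐ[ℝ] ℂ)
    have hdety : (F.map φ * B'.map φ).det ≠ 0 := by
      rw [← Matrix.map_mul, ← RingHom.mapMatrix_apply, ← RingHom.map_det]
      exact hy
    rw [Fintype.linearIndependent_iff]
    intro c hc
    have hcF : Matrix.vecMul c (F.map φ) = 0 := by
      rw [← hc]
      ext j
      simp [Matrix.vecMul, dotProduct, F, complexGradient, φ]
    refine congrFun (Matrix.eq_zero_of_vecMul_eq_zero hdety ?_)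
    rw [← Matrix.vecMul_vecMul, hcF, Matrix.zero_vecMul]
  have hDI : ∀ l, ∀ g ∈ vanishingIdeal ℝ X,
      vectorFieldDerivation (fun j => V j l) g ∈ vanishingIdeal ℝ X := by
    intro l g hg
    refine vectorFieldDerivation_mem_vanishingIdeal hframe (Δ := (F * B').det) ?_ hΔf ?_ hg
    · intro h
      have := hqX _ h
      rw [hdet] at this
      exact one_ne_zero this
    · intro i
      have := congrFun (congrFun (mul_tangentFields F B') i) l
      rw [Matrix.mul_apply] at this
      rw [vectorFieldDerivation_apply, ← Matrix.zero_apply (α := MvPolynomial (Fin d) ℝ) i l,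
        ← this]
      exact Finset.sum_congr rfl fun j _ => mul_comm _ _
  have hDN : ∀ l, ∀ g ∈ vanishingIdeal ℝ (realPoints X),
      vectorFieldDerivation (fun j => V j l) g ∈ vanishingIdeal ℝ (realPoints X) := by
    rintro l g hg _ ⟨hxX, x, rfl⟩
    rw [aeval_ofReal, Complex.ofReal_eq_zero]
    have hev : ∀ h : MvPolynomial (Fin d) ℝ, ∀ z : Fin d → ℝ,
        aeval (fun i => (z i : ℂ)) h = 0 ↔ eval z h = 0 := by
      intro h z
      rw [aeval_ofReal, Complex.ofReal_eq_zero]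
    refine eval_vectorFieldDerivation_eq_zero (hDI l) (fun z hz => ?_) fun h hh => ?_
    -- Since real equations define X, the real zeros of its real ideal are exactly the points of
    -- X(ℝ).
    · refine (hev _ _).1 (hg _ ⟨?_, z, rfl⟩)
      exact hreal.mem_of_forall_mem_vanishingIdeal fun h hh => (hev _ _).2 (hz h hh)
    · exact (hev _ _).1 (hh _ hxX)
  have hNm : vanishingIdeal ℝ (realPoints X) ≤ pointIdeal q := by
    intro g hg
    have := hg _ hp
    rw [aeval_ofReal] at this
    exact mem_pointIdeal_iff.2 (by exact_mod_cast this)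
  have hIm : vanishingIdeal ℝ X ≤ pointIdeal q := fun g hg => mem_pointIdeal_iff.2 (hqX g hg)
  refine Ideal.le_of_derivation (K := ℝ) (m := pointIdeal q) ?_ (hNm.trans le_sup_right)
    (eulerDerivation q V) (eulerDerivation_sub_mem q V hIm hfI B hVq) ?_ ?_
  · rw [sup_eq_right.2 hIm, Ideal.ne_top_iff_one, mem_pointIdeal_iff]
    simp
  · intro g hg
    rw [eulerDerivation_apply]
    exact sum_mem fun l _ => Ideal.mul_mem_left _ _ (hDI l g hg)
  · intro g hg
    rw [eulerDerivation_apply]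
    exact sum_mem fun l _ => Ideal.mul_mem_mul (X_sub_C_mem_pointIdeal q l) (hDN l g hg)

theorem theorem5p1 {d : ℕ} (X : Set (Fin d → ℂ))
    (hirr : IsIrreducibleVariety X)
    (hreal : IsDefinedByRealPolynomials X)
    (hsmooth : ∃ x ∈ realPoints X, IsSmoothPoint X x) :
    IsZariskiDenseIn (realPoints X) X ∧
      ∀ f : MvPolynomial (Fin d) ℂ,
        (∀ x ∈ realPoints X, MvPolynomial.eval x f = 0) →
          ∀ x ∈ X, MvPolynomial.eval x f = 0 := by
  obtain ⟨p, hp, hsm⟩ := hsmooth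
  have hle := hsm.vanishingIdeal_realPoints_le hirr hreal hp
  have hstar : ∀ x ∈ realPoints X, star x ∈ realPoints X := by
    rintro _ ⟨hx, q, rfl⟩
    refine ⟨hreal.star_mem _ hx, q, ?_⟩
    ext i
    simp
  have key : ∀ f : MvPolynomial (Fin d) ℂ,
      (∀ x ∈ realPoints X, MvPolynomial.eval x f = 0) →
        ∀ x ∈ X, MvPolynomial.eval x f = 0 := by
    intro f hf x hx
    obtain ⟨a, b, rfl⟩ := exists_eq_map_add_I_mul_map f
    obtain ⟨ha, hb⟩ := mem_vanishingIdeal_of_map_add_I_mul_map hstar hf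
    rw [map_add, map_mul, eval_map_ofReal, eval_map_ofReal, hle ha x hx, hle hb x hx]
    simp
  refine ⟨⟨Set.inter_subset_left, ?_⟩, key⟩
  rw [zariskiClosure_eq]
  intro x hx f hf
  exact key f (fun y hy => by simpa [aeval_eq_eval] using hf y hy) x hx
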